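/- Let $n,m\ge 2$ be integers and $\lambda_1,\lambda_2\in(0,1)$. Let $Q_{[1]}=(\lambda_1^{|i-j|})_{i,j=1}^{n}\in\mathbb R^{n\times n}$ and $Q_{[2]}=(\lambda_2^{|i-j|})_{i,j=1}^{m}\in\mathbb R^{m\times m}$ be one-dimensional Wasserstein-1 metric matrices, let $L_{[1]},L_{[2]}$ be their strictly lower triangular parts (so $Q_{[k]}=I+L_{[k]}+L_{[k]}^T$), and let $Q=Q_{[2]}\otimes Q_{[1]}\in\mathbb R^{nm\times nm}$ be the two-dimensional Wasserstein-1 metric matrix. Let $\|\cdot\|_1,\|\cdot\|_2,\|\cdot\|_\infty$ be the matrix norms induced by the corresponding vector norms, $\kappa_\#(Q)=\|Q\|_\#\|Q^{-1}\|_\#$ for $\#\in\{1,2,\infty\}$, $\rho(Q)$ the spectral radius, and $W(Q)=\{x^*Qx : x\in\mathbb C^{nm},\ x^*x=1\}$ the numerical range. Put $n_1=n$, $n_2=m$ and, for $k=1,2$, $$m_k=\min\Big\{1+2\|L_{[k]}\|_2,\ \frac{3-\lambda_k}{1-\lambda_k},\ \frac{2(1+\lambda_k)(1-\lambda_k^{n_k-1})}{1-\lambda_k}\Big\}.$$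 Then $Q$ is invertible and the following hold. (i) If $\lambda_1,\lambda_2\le\frac13$, then every eigenvalue $\alpha$ of $Q$ satisfies $0<\alpha<4$. (ii) Every eigenvalue $\alpha$ of $Q$ satisfies $0<\alpha\le\big(1+2\|L_{[1]}\|_2\cos\frac{\pi}{n+1}\big)\big(1+2\|L_{[2]}\|_2\cos\frac{\pi}{m+1}\big)$. (iii) $\rho(Q)\ge(1+\lambda_1)(1+\lambda_2)$. (iv) $W(Q)\subset\Big(0,\ \frac{(1+\lambda_1)(1+\lambda_2)(1-\lambda_1^{n-1})(1-\lambda_2^{m-1})}{(1-\lambda_1)(1-\lambda_2)}\Big]$. (v) $\frac{1}{(1+\lambda_1)^2(1+\lambda_2)^2}\le\|Q\|_1=\|Q\|_\infty\le\Big(1+\frac{2\lambda_1(1-\lambda_1^{n-1})}{1-\lambda_1}\Big)\Big(1+\frac{2\lambda_2(1-\lambda_2^{m-1})}{1-\lambda_2}\Big)$. (vi) $\frac{1}{(1+\lambda_1)^2(1+\lambda_2)^2}\le\|Q\|_2\le m_1m_2$. (vii) $\|Q^{-1}\|_1=\|Q^{-1}\|_\infty\ge\frac{(1-\lambda_1)(1-\lambda_2)}{(1+\lambda_1)(1+\lambda_2)(1-\lambda_1^n)^2(1-\lambda_2^m)^2}$.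 (viii) $\frac{(1-\lambda_1)(1-\lambda_2)}{(1+\lambda_1)(1+\lambda_2)}\le\|Q^{-1}\|_2\le\frac{(1+\lambda_1)(1+\lambda_2)}{(1-\lambda_1)(1-\lambda_2)}$. (ix) $\frac{(1-\lambda_1)(1-\lambda_2)}{(1+\lambda_1)^3(1+\lambda_2)^3(1-\lambda_1^n)^2(1-\lambda_2^m)^2}\le\kappa_1(Q)=\kappa_\infty(Q)\le\frac{(1+\lambda_1)(1+\lambda_2)(1-\lambda_1+2\lambda_1(1-\lambda_1^{n-1}))(1-\lambda_2+2\lambda_2(1-\lambda_2^{m-1}))}{(1-\lambda_1)^2(1-\lambda_2)^2}$. (x) $\frac{(1-\lambda_1)(1-\lambda_2)}{(1+\lambda_1)^3(1+\lambda_2)^3}\le\kappa_2(Q)\le m_1m_2\cdot\frac{(1+\lambda_1)(1+\lambda_2)}{(1-\lambda_1)(1-\lambda_2)}$. -/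

import Mathlib

open scoped Kronecker

noncomputable section

namespace WassersteinMetric

/-- The one-dimensional Wasserstein-1 metric matrix of order `n` with parameter `lam`:
its `(i, j)` entry is `lam ^ |i - j|`. -/
def oneDim (n : ℕ) (lam : ℝ) : Matrix (Fin n) (Fin n) ℝ :=
  Matrix.of fun i j => lam ^ ((i : ℤ) - (j : ℤ)).natAbs

/-- The strictly lower triangular part `L` of `oneDim n lam`. -/
def strictLower (n : ℕ) (lam : ℝ) : Matrix (Fin n) (Fin n) ℝ :=
  Matrix.of fun i j => if j < i then lam ^ ((i : ℕ) - (j : ℕ)) else 0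

/-- The decomposition `Q = I + L + Lᵀ`. -/
theorem oneDim_eq (n : ℕ) (lam : ℝ) :
    oneDim n lam = 1 + strictLower n lam + (strictLower n lam).transpose := by
  ext i j
  simp only [oneDim, strictLower, Matrix.of_apply, Matrix.add_apply, Matrix.transpose_apply]
  rcases lt_trichotomy i j with h | h | h
  · have h1 : ¬ j < i := not_lt.mpr h.le
    have h2 : ((i : ℤ) - (j : ℤ)).natAbs = (j : ℕ) - (i : ℕ) := by
      have : (i : ℕ) < j := h
      omega
    simp [Matrix.one_apply_ne h.ne, h, h1, h2]
  · subst h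
    simp
  · have h1 : ¬ i < j := not_lt.mpr h.le
    have h2 : ((i : ℤ) - (j : ℤ)).natAbs = (i : ℕ) - (j : ℕ) := by
      have : (j : ℕ) < i := h
      omega
    simp [Matrix.one_apply_ne h.ne', h, h1, h2]

/-- The two-dimensional Wasserstein-1 metric matrix `Q = Q₂ ⊗ Q₁`, where `Q₁` has order `n` and
parameter `lam₁`, and `Q₂` has order `m` and parameter `lam₂`. -/
def twoDim (n m : ℕ) (lam₁ lam₂ : ℝ) : Matrix (Fin m × Fin n) (Fin m × Fin n) ℝ :=
  oneDim m lam₂ ⊗ₖ oneDim n lam₁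

section General

variable {ι : Type*} [Fintype ι] [DecidableEq ι]

/-- A real matrix viewed as a complex matrix. -/
def toComplex (A : Matrix ι ι ℝ) : Matrix ι ι ℂ := A.map Complex.ofReal

/-- The set `σ(A)` of all (complex) eigenvalues of `A`. -/
def sigma (A : Matrix ι ι ℝ) : Set ℂ :=
  {α | Module.End.HasEigenvalue (Matrix.toLin' (toComplex A)) α}

/-- The spectral radius `ρ(A)` of `A`, over the complex numbers. -/
def rho (A : Matrix ι ι ℝ) : ℝ := (spectralRadius ℂ (toComplex A)).toReal

/-- The numerical range `W(A) = {x* A x : x ∈ ℂ^ι, x* x = 1}`. -/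
def numRange (A : Matrix ι ι ℝ) : Set ℂ :=
  {z | ∃ x : ι → ℂ, star x ⬝ᵥ x = 1 ∧ z = star x ⬝ᵥ (toComplex A).mulVec x}

/-- The matrix 1-norm: the maximum absolute column sum. -/
def norm1 (A : Matrix ι ι ℝ) : ℝ := ⨆ j, ∑ i, |A i j|

/-- The matrix ∞-norm: the maximum absolute row sum. -/
def normInf (A : Matrix ι ι ℝ) : ℝ := ⨆ i, ∑ j, |A i j|

/-- The matrix 2-norm: the operator norm on Euclidean space. -/
def norm2 (A : Matrix ι ι ℝ) : ℝ := ‖Matrix.toEuclideanCLM (n := ι) (𝕜 := ℝ) A‖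

/-- Condition number of a nonsingular matrix for the 1-norm. -/
def kappa1 (A : Matrix ι ι ℝ) : ℝ := norm1 A * norm1 A⁻¹

/-- Condition number of a nonsingular matrix for the ∞-norm. -/
def kappaInf (A : Matrix ι ι ℝ) : ℝ := normInf A * normInf A⁻¹

/-- Condition number of a nonsingular matrix for the 2-norm. -/
def kappa2 (A : Matrix ι ι ℝ) : ℝ := norm2 A * norm2 A⁻¹

end General

/-- The quantity
`min {1 + 2‖L‖₂, (3 - lam)/(1 - lam), 2(1 + lam)(1 - lam^(n-1))/(1 - lam)}`
(used only for `1 ≤ n`). -/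
def minBound (n : ℕ) (lam : ℝ) : ℝ :=
  min (1 + 2 * norm2 (strictLower n lam))
    (min ((3 - lam) / (1 - lam)) (2 * (1 + lam) * (1 - lam ^ (n - 1)) / (1 - lam)))

end WassersteinMetric

end

/-!
The two-dimensional matrix is the Kronecker product `Q = Q₂ ⊗ Q₁` of symmetric positive definite
matrices, so every claim is reduced to bounds on the one-dimensional factors.

Upper spectral bounds are written as order relations `Q_k ≤ c_k`, encoded as positive
semidefiniteness of `c_k • 1 - Q_k`. They multiply under Kronecker products
(`posSemidef_smul_one_sub_kronecker`), and the resulting relation `0 < Q ≤ c₁ c₂` bounds the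
numerical range (`numRange_bounds`), hence the eigenvalues (`sigma_subset_numRange`), and the
Euclidean operator norm (`norm2_le_of_posSemidef`).

The one-dimensional bounds come from two sources. The first is Schur's test, which bounds the
quadratic form of a symmetric matrix by its largest absolute row sum
(`abs_dotProduct_mulVec_le_of_rowSum_le`); the row sums of `oneDim` are geometric sums
(`sum_abs_oneDim`). The second is the identity `x ⬝ Q x = x ⬝ x + 2 (x ⬝ L x)` together with the
Haagerup–de la Harpe inequality `⟪T x, x⟫ ≤ ‖T‖ cos (π / (n + 1)) ‖x‖²` for operators with
`T ^ n = 0` (`inner_apply_self_le_norm_mul_cos`), applied to the nilpotent matrix `L`.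

Positive definiteness and all statements about `Q⁻¹` rest on the explicit tridiagonal inverse
`oneDimInv` of `oneDim` (`oneDim_mul_oneDimInv`): Schur's test bounds its quadratic form from above
and, after subtracting a multiple of the identity, away from zero. The lower bounds on norms are
read off from single entries or rows, and the one for the spectral radius from the Rayleigh quotient at
the product vector `(e₀ + e₁) ⊗ (e₀ + e₁)`.
-/

open scoped Kronecker

namespace WassersteinMetric

open Matrix

/-! ### Quadratic forms, operator norm and numerical range of symmetric matrices -/

section Forms

variable {ι κ : Type*} [Fintype ι] [Fintype κ]

/-- Schur's test for a symmetric matrix: the quadratic form is bounded by the largest absolute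
row sum, since `2 |xᵢ xⱼ| ≤ xᵢ² + xⱼ²`. -/
theorem abs_dotProduct_mulVec_le_of_rowSum_le {A : Matrix ι ι ℝ} (hA : A.IsSymm) {c : ℝ}
    (hc : ∀ i, ∑ j, |A i j| ≤ c) (x : ι → ℝ) : |x ⬝ᵥ A *ᵥ x| ≤ c * (x ⬝ᵥ x) := by
  have hsym : ∑ i, ∑ j, |A i j| * x j ^ 2 = ∑ i, ∑ j, |A i j| * x i ^ 2 := by
    rw [Finset.sum_comm]
    refine Finset.sum_congr rfl fun i _ => Finset.sum_congr rfl fun j _ => ?_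
    rw [hA.apply]
  calc |x ⬝ᵥ A *ᵥ x| = |∑ i, ∑ j, x i * (A i j * x j)| := by
        simp only [dotProduct, mulVec, Finset.mul_sum]
    _ ≤ ∑ i, ∑ j, (|A i j| * x i ^ 2 + |A i j| * x j ^ 2) / 2 := by
        refine (Finset.abs_sum_le_sum_abs _ _).trans (Finset.sum_le_sum fun i _ => ?_)
        refine (Finset.abs_sum_le_sum_abs _ _).trans (Finset.sum_le_sum fun j _ => ?_)
        rw [abs_mul, abs_mul, ← sq_abs (x i), ← sq_abs (x j)]
        nlinarith [mul_nonneg (abs_nonneg (A i j)) (sq_nonneg (|x i| - |x j|))]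
    _ = ∑ i, ∑ j, |A i j| * x i ^ 2 := by
        simp only [← Finset.sum_div, Finset.sum_add_distrib]
        rw [hsym]; ring
    _ ≤ ∑ i, c * x i ^ 2 := by
        refine Finset.sum_le_sum fun i _ => ?_
        rw [← Finset.sum_mul]
        exact mul_le_mul_of_nonneg_right (hc i) (sq_nonneg _)
    _ = c * (x ⬝ᵥ x) := by
        simp only [dotProduct, Finset.mul_sum, pow_two]

theorem norm_toLp_sq (x : ι → ℝ) : ‖(WithLp.toLp 2 x : EuclideanSpace ℝ ι)‖ ^ 2 = x ⬝ᵥ x := by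
  rw [← real_inner_self_eq_norm_sq, EuclideanSpace.inner_eq_star_dotProduct]
  simp

/-- For a symmetric real matrix the complex quadratic form at `u + i v` is real, and it is the sum
of the real quadratic forms at `u` and `v`. -/
theorem star_dotProduct_toComplex_mulVec {A : Matrix ι ι ℝ} (hA : A.IsSymm) (x : ι → ℂ) :
    star x ⬝ᵥ (toComplex A) *ᵥ x =
      (((fun i => (x i).re) ⬝ᵥ A *ᵥ (fun i => (x i).re) +
        (fun i => (x i).im) ⬝ᵥ A *ᵥ (fun i => (x i).im) : ℝ) : ℂ) := by
  have hsym : ∑ i, ∑ j, (x i).im * (A i j * (x j).re) =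
      ∑ i, ∑ j, (x i).re * (A i j * (x j).im) := by
    rw [Finset.sum_comm]
    refine Finset.sum_congr rfl fun i _ => Finset.sum_congr rfl fun j _ => ?_
    rw [hA.apply]; ring
  apply Complex.ext
  · simp [dotProduct, mulVec, toComplex, Finset.mul_sum, Finset.sum_add_distrib]
  · simp [dotProduct, mulVec, toComplex, Finset.mul_sum, Finset.sum_add_distrib, hsym]

variable [DecidableEq ι] [DecidableEq κ]

theorem dotProduct_smul_one_sub_mulVec (A : Matrix ι ι ℝ) (c : ℝ) (x : ι → ℝ) :
    x ⬝ᵥ (c • (1 : Matrix ι ι ℝ) - A) *ᵥ x = c * (x ⬝ᵥ x) - x ⬝ᵥ A *ᵥ x := by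
  rw [sub_mulVec, smul_mulVec, one_mulVec, dotProduct_sub, dotProduct_smul, smul_eq_mul]

theorem posSemidef_smul_one_sub_iff {A : Matrix ι ι ℝ} (hA : A.IsSymm) (c : ℝ) :
    (c • (1 : Matrix ι ι ℝ) - A).PosSemidef ↔ ∀ x, x ⬝ᵥ A *ᵥ x ≤ c * (x ⬝ᵥ x) := by
  have hH : (c • (1 : Matrix ι ι ℝ) - A).IsHermitian := by
    simp [IsHermitian, hA.eq]
  rw [posSemidef_iff_dotProduct_mulVec]
  simp only [hH, star_trivial, true_and, dotProduct_smul_one_sub_mulVec, sub_nonneg]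

/-- If `A ≤ a` and `0 ≤ B ≤ b` then `B ⊗ A ≤ b a`, because
`b a - B ⊗ A = B ⊗ (a - A) + (b - B) ⊗ a`. -/
theorem posSemidef_smul_one_sub_kronecker {A : Matrix ι ι ℝ} {B : Matrix κ κ ℝ} {a b : ℝ}
    (hB : B.PosSemidef) (ha : 0 ≤ a)
    (hAa : (a • (1 : Matrix ι ι ℝ) - A).PosSemidef)
    (hBb : (b • (1 : Matrix κ κ ℝ) - B).PosSemidef) :
    ((b * a) • (1 : Matrix (κ × ι) (κ × ι) ℝ) - B ⊗ₖ A).PosSemidef := by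
  have h1 := hB.kronecker hAa
  have h2 := hBb.kronecker ((PosSemidef.one (n := ι) (R := ℝ)).smul ha)
  have h : (b * a) • (1 : Matrix (κ × ι) (κ × ι) ℝ) - B ⊗ₖ A =
      B ⊗ₖ (a • (1 : Matrix ι ι ℝ) - A) +
        (b • (1 : Matrix κ κ ℝ) - B) ⊗ₖ (a • (1 : Matrix ι ι ℝ)) := by
    rw [← one_kronecker_one]
    ext ⟨i, i'⟩ ⟨j, j'⟩
    simp only [kroneckerMap_apply, Matrix.sub_apply, Matrix.add_apply, Matrix.smul_apply,
      smul_eq_mul]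
    ring
  rw [h]
  exact h1.add h2

theorem inner_toEuclideanCLM_self (A : Matrix ι ι ℝ) (x : ι → ℝ) :
    inner ℝ (toEuclideanCLM (n := ι) (𝕜 := ℝ) A (WithLp.toLp 2 x)) (WithLp.toLp 2 x) =
      x ⬝ᵥ A *ᵥ x := by
  simp [toEuclideanCLM_toLp, EuclideanSpace.inner_eq_star_dotProduct]

theorem dotProduct_mulVec_le_norm2 (A : Matrix ι ι ℝ) (x : ι → ℝ) :
    x ⬝ᵥ A *ᵥ x ≤ norm2 A * (x ⬝ᵥ x) := by
  rw [← inner_toEuclideanCLM_self, ← norm_toLp_sq, pow_two, ← mul_assoc]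
  refine (real_inner_le_norm _ _).trans ?_
  gcongr
  exact ContinuousLinearMap.le_opNorm _ _

/-- The order `0 ≤ A ≤ c` bounds the operator norm by `c`. -/
theorem norm2_le_of_posSemidef {A : Matrix ι ι ℝ} (hA : A.PosSemidef) {c : ℝ} (hc : 0 ≤ c)
    (hAc : (c • (1 : Matrix ι ι ℝ) - A).PosSemidef) : norm2 A ≤ c := by
  have hsym : A.IsSymm := by simpa [IsHermitian, IsSymm] using hA.isHermitian
  have hT : (toEuclideanCLM (n := ι) (𝕜 := ℝ) A).IsSymmetric := by
    exact isSymmetric_toEuclideanLin_iff.2 hA.isHermitian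
  rw [norm2, ContinuousLinearMap.norm_eq_iSup_rayleighQuotient _ hT]
  refine ciSup_le fun x => ?_
  have h0 : 0 ≤ x.ofLp ⬝ᵥ A *ᵥ x.ofLp := by simpa using hA.dotProduct_mulVec_nonneg x.ofLp
  have h1 := (posSemidef_smul_one_sub_iff hsym c).1 hAc x.ofLp
  rw [← inner_toEuclideanCLM_self] at h0 h1
  rw [← norm_toLp_sq] at h1
  rw [ContinuousLinearMap.rayleighQuotient, ContinuousLinearMap.reApplyInnerSelf]
  rw [RCLike.re_to_real, abs_of_nonneg (div_nonneg h0 (sq_nonneg _))]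
  exact div_le_of_le_mul₀ (sq_nonneg _) hc h1

theorem numRange_bounds {A : Matrix ι ι ℝ} (hA : A.PosDef) {c : ℝ}
    (hAc : (c • (1 : Matrix ι ι ℝ) - A).PosSemidef) {z : ℂ} (hz : z ∈ numRange A) :
    ∃ a : ℝ, z = (a : ℂ) ∧ 0 < a ∧ a ≤ c := by
  obtain ⟨x, hx, rfl⟩ := hz
  have hsym : A.IsSymm := by simpa [IsHermitian, IsSymm] using hA.isHermitian
  set u : ι → ℝ := fun i => (x i).re with hu
  set v : ι → ℝ := fun i => (x i).im with hv
  have huv : u ⬝ᵥ u + v ⬝ᵥ v = 1 := by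
    have h := star_dotProduct_toComplex_mulVec (isSymm_one (n := ι) (α := ℝ)) x
    have h1 : toComplex (1 : Matrix ι ι ℝ) = 1 := by simp [toComplex]
    rw [h1, one_mulVec, one_mulVec, one_mulVec, hx] at h
    exact_mod_cast h.symm
  have hub := (posSemidef_smul_one_sub_iff hsym c).1 hAc
  refine ⟨_, star_dotProduct_toComplex_mulVec hsym x, ?_, ?_⟩
  · have hnn : ∀ y : ι → ℝ, 0 ≤ y ⬝ᵥ A *ᵥ y := fun y => by
      simpa using hA.posSemidef.dotProduct_mulVec_nonneg y
    have hpos : ∀ y : ι → ℝ, y ≠ 0 → 0 < y ⬝ᵥ A *ᵥ y := fun y hy => by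
      simpa using hA.dotProduct_mulVec_pos hy
    by_cases h0 : u = 0
    · refine add_pos_of_nonneg_of_pos (hnn _) (hpos _ fun h0' => ?_)
      change v = 0 at h0'
      simp [h0, h0'] at huv
    · exact add_pos_of_pos_of_nonneg (hpos _ h0) (hnn _)
  · calc _ ≤ c * (u ⬝ᵥ u) + c * (v ⬝ᵥ v) := add_le_add (hub u) (hub v)
      _ = c := by rw [← mul_add, huv, mul_one]

theorem sigma_subset_numRange (A : Matrix ι ι ℝ) : sigma A ⊆ numRange A := by
  intro α hα
  obtain ⟨v, hv⟩ := Module.End.HasEigenvalue.exists_hasEigenvector hα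
  have hn : ‖(WithLp.toLp 2 v : EuclideanSpace ℂ ι)‖ ≠ 0 := by simpa using hv.2
  -- normalise the eigenvector to Euclidean length one
  set r : ℂ := ((‖(WithLp.toLp 2 v : EuclideanSpace ℂ ι)‖⁻¹ : ℝ) : ℂ) with hr
  have hx : star (r • v) ⬝ᵥ (r • v) = 1 := by
    have h := inner_self_eq_norm_sq_to_K (𝕜 := ℂ) (r • (WithLp.toLp 2 v : EuclideanSpace ℂ ι))
    have h1 : ‖r • (WithLp.toLp 2 v : EuclideanSpace ℂ ι)‖ = 1 := by
      rw [norm_smul, hr]; simp [hn]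
    rw [h1, EuclideanSpace.inner_eq_star_dotProduct] at h
    rw [dotProduct_comm]
    simpa using h
  refine ⟨r • v, hx, ?_⟩
  have he : toComplex A *ᵥ v = α • v := by simpa using hv.apply_eq_smul
  rw [mulVec_smul, he, smul_comm, dotProduct_smul, hx, smul_eq_mul, mul_one]

/-- The Rayleigh quotient of a symmetric matrix is at most its spectral radius: for the self-adjoint
operator it induces on `ℂ^ι`, the spectral radius is the operator norm. -/
theorem dotProduct_mulVec_le_rho {A : Matrix ι ι ℝ} (hA : A.IsSymm) (x : ι → ℝ) :
    x ⬝ᵥ A *ᵥ x ≤ rho A * (x ⬝ᵥ x) := by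
  set T := toEuclideanCLM (n := ι) (𝕜 := ℂ) (toComplex A) with hT
  have hsa : IsSelfAdjoint (toComplex A) := by
    rw [IsSelfAdjoint]
    ext i j
    simp [toComplex, star_apply, hA.apply]
  have hrho : rho A = ‖T‖ := by
    have h1 : spectralRadius ℂ (toComplex A) = spectralRadius ℂ T := by
      rw [spectralRadius, spectralRadius, hT, AlgEquiv.spectrum_eq]
    rw [rho, h1, IsSelfAdjoint.spectralRadius_eq_nnnorm (hsa.map toEuclideanCLM)]
    simp [T]
  have hquad := star_dotProduct_toComplex_mulVec hA (fun i => (x i : ℂ))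
  have hinner : inner ℂ (T (WithLp.toLp 2 fun i => (x i : ℂ))) (WithLp.toLp 2 fun i => (x i : ℂ)) =
      ((x ⬝ᵥ A *ᵥ x : ℝ) : ℂ) := by
    rw [← inner_conj_symm, EuclideanSpace.inner_eq_star_dotProduct, hT, toEuclideanCLM_toLp,
      dotProduct_comm, hquad]
    simp
  have hnorm : ‖(WithLp.toLp 2 fun i => (x i : ℂ) : EuclideanSpace ℂ ι)‖ ^ 2 = x ⬝ᵥ x := by
    rw [EuclideanSpace.norm_sq_eq]
    simp [dotProduct, pow_two]
  calc x ⬝ᵥ A *ᵥ x ≤ ‖((x ⬝ᵥ A *ᵥ x : ℝ) : ℂ)‖ := by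
        rw [Complex.norm_real]; exact le_abs_self _
    _ ≤ ‖T‖ * ‖(WithLp.toLp 2 fun i => (x i : ℂ) : EuclideanSpace ℂ ι)‖ ^ 2 := by
        rw [← hinner, pow_two, ← mul_assoc]
        refine (norm_inner_le_norm _ _).trans ?_
        gcongr
        exact T.le_opNorm _
    _ = rho A * (x ⬝ᵥ x) := by rw [hrho, hnorm]

end Forms

/-! ### The numerical range of a nilpotent operator -/

section Nilpotent

variable {E : Type*} [NormedAddCommGroup E] [InnerProductSpace ℝ E]

/-- The Haagerup–de la Harpe inequality for a nilpotent contraction `T` with `T ^ n = 0`. The form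
`B u v = ⟪u, v⟫ - ⟪T u, T v⟫` is positive semidefinite, and along the orbit `a k = T ^ k x` the sums
of `d k = B (a k) (a k)` and of `e k = B (a (k + 1)) (a k)` telescope to `‖x‖²` and `⟪T x, x⟫`.
Cauchy–Schwarz for `B`, weighted by the values `s k = sin (k θ)`, compares the two sums, because
`s (k + 2) + s k = 2 cos θ * s (k + 1)`. -/
theorem inner_apply_self_le_cos_of_contraction (T : E →L[ℝ] E) (hT : ‖T‖ ≤ 1) {n : ℕ}
    (hn : T ^ n = 0) (x : E) :
    inner ℝ (T x) x ≤ Real.cos (Real.pi / ((n : ℝ) + 1)) * ‖x‖ ^ 2 := by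
  set θ := Real.pi / ((n : ℝ) + 1) with hθ
  have hn1 : (0 : ℝ) < (n : ℝ) + 1 := by positivity
  let s : ℕ → ℝ := fun k => Real.sin (k * θ)
  let a : ℕ → E := fun k => (T ^ k) x
  let d : ℕ → ℝ := fun k => ‖a k‖ ^ 2 - ‖a (k + 1)‖ ^ 2
  let e : ℕ → ℝ := fun k => inner ℝ (a (k + 1)) (a k) - inner ℝ (a (k + 2)) (a (k + 1))
  have ha_succ : ∀ k, a (k + 1) = T (a k) := fun k => by
    simp only [a, pow_succ', mul_apply_eq_comp]
  have ha_n : a n = 0 := by simp only [a, hn, _root_.zero_apply]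
  have ha_n1 : a (n + 1) = 0 := by rw [ha_succ, ha_n, map_zero]
  have hs_pos : ∀ k < n, 0 < s (k + 1) := fun k hk => by
    have hk' : ((k + 1 : ℕ) : ℝ) < (n : ℝ) + 1 := by exact_mod_cast Nat.succ_lt_succ hk
    apply Real.sin_pos_of_pos_of_lt_pi
    · have := Real.pi_pos; positivity
    · calc ((k + 1 : ℕ) : ℝ) * θ < ((n : ℝ) + 1) * θ := by
            have := Real.pi_pos
            gcongr
        _ = Real.pi := by rw [hθ]; field_simp
  have hs_n : s (n + 1) = 0 := by
    have : ((n + 1 : ℕ) : ℝ) * θ = Real.pi := by rw [hθ]; push_cast; field_simp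
    simp only [s, this, Real.sin_pi]
  have hs_zero : s 0 = 0 := by simp [s]
  have hs_rec : ∀ k, s (k + 2) + s k = 2 * Real.cos θ * s (k + 1) := fun k => by
    have h1 : ((k + 2 : ℕ) : ℝ) * θ = ((k + 1 : ℕ) : ℝ) * θ + θ := by push_cast; ring
    have h2 : (k : ℝ) * θ = ((k + 1 : ℕ) : ℝ) * θ - θ := by push_cast; ring
    simp only [s]
    rw [h1, h2, Real.sin_add, Real.sin_sub]; ring
  have hd_n : d n = 0 := by simp [d, ha_n, ha_n1]
  -- nonnegativity of `‖u‖² - ‖T u‖²` at `u = p a_k - q a_{k+1}`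
  have hcs : ∀ k (p q : ℝ), 2 * (p * q) * e k ≤ p ^ 2 * d k + q ^ 2 * d (k + 1) := by
    intro k p q
    have h : ‖T (p • a k - q • a (k + 1))‖ ^ 2 ≤ ‖p • a k - q • a (k + 1)‖ ^ 2 := by
      have := T.le_of_opNorm_le hT (p • a k - q • a (k + 1))
      rw [one_mul] at this
      gcongr
    rw [map_sub, map_smul, map_smul, ← ha_succ, ← ha_succ, norm_sub_sq_real, norm_sub_sq_real,
      norm_smul, norm_smul, norm_smul, norm_smul, mul_pow, mul_pow, mul_pow, mul_pow,
      Real.norm_eq_abs, Real.norm_eq_abs, sq_abs, sq_abs, real_inner_smul_left,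
      real_inner_smul_right, real_inner_smul_left, real_inner_smul_right,
      real_inner_comm (a (k + 1)) (a k), real_inner_comm (a (k + 1 + 1)) (a (k + 1))] at h
    simp only [d, e]
    linarith
  -- `g k` is the share of `d k` coming from the pair `(k - 1, k)`; the share coming from
  -- `(k, k + 1)` is `s (k + 2) / s (k + 1) * d k`
  let g : ℕ → ℝ := fun k => s k / s (k + 1) * d k
  have hterm : ∀ k < n, 2 * e k ≤ s (k + 2) / s (k + 1) * d k + g (k + 1) := by
    intro k hk
    have hp := hs_pos k hk
    rcases Nat.lt_or_ge (k + 1) n with hk1 | hk1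
    · have hq := hs_pos (k + 1) hk1
      have h := hcs k (s (k + 2)) (s (k + 1))
      have hpq : 0 < s (k + 2) * s (k + 1) := mul_pos hq hp
      refine le_of_mul_le_mul_left ?_ hpq
      have hr : s (k + 2) * s (k + 1) * (s (k + 2) / s (k + 1) * d k + g (k + 1)) =
          s (k + 2) ^ 2 * d k + s (k + 1) ^ 2 * d (k + 1) := by
        simp only [g]
        field_simp [hp.ne', show s (k + 1 + 1) ≠ 0 from hq.ne']
      rw [hr]; linarith
    -- at the last index all terms vanish, `g (k + 1)` through `d n = 0`
    · obtain rfl : n = k + 1 := by omega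
      simp [e, g, hs_n, ha_n, ha_n1, hd_n]
  have hsum_d : ∑ k ∈ Finset.range n, d k = ‖x‖ ^ 2 := by
    rw [Finset.sum_range_sub' (fun k => ‖a k‖ ^ 2), ha_n]
    simp [a]
  have hsum_e : ∑ k ∈ Finset.range n, e k = inner ℝ (T x) x := by
    rw [Finset.sum_range_sub' (fun k => inner ℝ (a (k + 1)) (a k)), ha_n]
    simp [a]
  have hg : ∑ k ∈ Finset.range n, g (k + 1) = ∑ k ∈ Finset.range n, g k := by
    have h := Finset.sum_range_sub g n
    have h0 : g 0 = 0 := by simp [g, hs_zero]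
    have hgn : g n = 0 := by simp [g, hd_n]
    rw [Finset.sum_sub_distrib, h0, hgn] at h
    linarith
  have hfin : ∑ k ∈ Finset.range n, 2 * e k ≤ ∑ k ∈ Finset.range n, 2 * Real.cos θ * d k := by
    calc _ ≤ ∑ k ∈ Finset.range n, (s (k + 2) / s (k + 1) * d k + g (k + 1)) :=
          Finset.sum_le_sum fun k hk => hterm k (Finset.mem_range.1 hk)
      _ = ∑ k ∈ Finset.range n, (s (k + 2) / s (k + 1) * d k + g k) := by
          rw [Finset.sum_add_distrib, hg, Finset.sum_add_distrib]
      _ = _ := by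
          refine Finset.sum_congr rfl fun k hk => ?_
          have hp := (hs_pos k (Finset.mem_range.1 hk)).ne'
          simp only [g]
          rw [← add_mul, ← add_div, hs_rec, mul_div_cancel_right₀ _ hp]
  rw [← Finset.mul_sum, ← Finset.mul_sum, hsum_d, hsum_e] at hfin
  linarith

theorem inner_apply_self_le_norm_mul_cos (T : E →L[ℝ] E) {n : ℕ} (hn : T ^ n = 0) (x : E) :
    inner ℝ (T x) x ≤ ‖T‖ * Real.cos (Real.pi / ((n : ℝ) + 1)) * ‖x‖ ^ 2 := by
  rcases eq_or_ne T 0 with rfl | h0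
  · simp
  have hT : 0 < ‖T‖ := norm_pos_iff.2 h0
  have h := inner_apply_self_le_cos_of_contraction (‖T‖⁻¹ • T)
    (by rw [norm_smul, norm_inv, norm_norm, inv_mul_cancel₀ hT.ne']) (n := n)
    (by rw [smul_pow, hn, smul_zero]) x
  rw [_root_.smul_apply, real_inner_smul_left, inv_mul_le_iff₀ hT] at h
  rwa [mul_assoc]

end Nilpotent

/-! ### The one-dimensional matrix and its row sums -/

noncomputable section OneDim

theorem isSymm_oneDim (n : ℕ) (lam : ℝ) : (oneDim n lam).IsSymm := by
  rw [oneDim_eq, IsSymm, transpose_add, transpose_add, transpose_one, transpose_transpose]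
  abel

theorem sum_abs_oneDim {n : ℕ} {lam : ℝ} (h0 : 0 < lam) (h1 : lam < 1) (i : Fin n) :
    ∑ j, |oneDim n lam i j| = (1 + lam - lam ^ ((i : ℕ) + 1) - lam ^ (n - i)) / (1 - lam) := by
  have hi := i.isLt
  have hsum : ∑ j, |oneDim n lam i j| =
      ∑ j ∈ Finset.range n, lam ^ (((i : ℕ) : ℤ) - (j : ℤ)).natAbs := by
    rw [Finset.sum_range]
    refine Finset.sum_congr rfl fun j _ => ?_
    rw [oneDim, of_apply, abs_of_pos (pow_pos h0 _)]
  have hsplit : n = ((i : ℕ) + 1) + (n - 1 - i) := by omega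
  have hleft : ∑ j ∈ Finset.range ((i : ℕ) + 1), lam ^ (((i : ℕ) : ℤ) - (j : ℤ)).natAbs =
      ∑ j ∈ Finset.range ((i : ℕ) + 1), lam ^ j := by
    rw [← Finset.sum_range_reflect]
    refine Finset.sum_congr rfl fun j hj => ?_
    rw [Finset.mem_range] at hj
    congr 1
    omega
  have hright : ∑ j ∈ Finset.range (n - 1 - i),
      lam ^ (((i : ℕ) : ℤ) - (((i : ℕ) + 1 + j : ℕ) : ℤ)).natAbs =
      lam * ∑ j ∈ Finset.range (n - 1 - i), lam ^ j := by
    rw [Finset.mul_sum]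
    refine Finset.sum_congr rfl fun j hj => ?_
    rw [← pow_succ']
    congr 1
    omega
  have hpow : lam ^ (n - (i : ℕ)) = lam * lam ^ (n - 1 - (i : ℕ)) := by
    rw [← pow_succ']
    congr 1
    omega
  have g1 := mul_neg_geom_sum lam ((i : ℕ) + 1)
  have g2 := mul_neg_geom_sum lam (n - 1 - i)
  rw [hsum, eq_div_iff (by linarith), hpow]
  rw [show Finset.range n = Finset.range (((i : ℕ) + 1) + (n - 1 - i)) by rw [← hsplit],
    Finset.sum_range_add, hleft, hright]
  linear_combination g1 + lam * g2

theorem sum_abs_oneDim_le {n : ℕ} (hn : 2 ≤ n) {lam : ℝ} (h0 : 0 < lam) (h1 : lam < 1)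
    (i : Fin n) :
    ∑ j, |oneDim n lam i j| ≤ (1 + lam) * (1 - lam ^ (n - 1)) / (1 - lam) := by
  rw [sum_abs_oneDim h0 h1]
  refine div_le_div_of_nonneg_right ?_ (by linarith)
  have hi := i.isLt
  have hpow : lam ^ n = lam * lam ^ (n - 1) := by
    rw [← pow_succ']
    congr 1
    omega
  -- one of the two exponents on the right is at most `n - 1` (`i + 1` unless `i` is the last row),
  -- and the other is at most `n`
  have key : lam ^ (n - 1) + lam ^ n ≤ lam ^ ((i : ℕ) + 1) + lam ^ (n - (i : ℕ)) := by
    rcases Nat.lt_or_ge ((i : ℕ) + 1) n with h | h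
    · exact add_le_add (pow_le_pow_of_le_one h0.le h1.le (by omega))
        (pow_le_pow_of_le_one h0.le h1.le (by omega))
    · rw [add_comm]
      exact add_le_add (pow_le_pow_of_le_one h0.le h1.le (by omega))
        (pow_le_pow_of_le_one h0.le h1.le (by omega))
  nlinarith

theorem sum_abs_oneDim_le_one_add {n : ℕ} {lam : ℝ} (h0 : 0 < lam) (h1 : lam < 1) (i : Fin n) :
    ∑ j, |oneDim n lam i j| ≤ 1 + 2 * lam * (1 - lam ^ (n - 1)) / (1 - lam) := by
  have hi := i.isLt
  have hpow : lam ^ n = lam * lam ^ (n - 1) := by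
    rw [← pow_succ']
    congr 1
    omega
  have h2 : lam ^ n ≤ lam ^ ((i : ℕ) + 1) := pow_le_pow_of_le_one h0.le h1.le (by omega)
  have h3 : lam ^ n ≤ lam ^ (n - (i : ℕ)) := pow_le_pow_of_le_one h0.le h1.le (by omega)
  have h4 : 1 - lam ≠ 0 := by linarith
  have h5 : 1 + 2 * lam * (1 - lam ^ (n - 1)) / (1 - lam) =
      (1 + lam - 2 * lam ^ n) / (1 - lam) := by
    rw [hpow]; field_simp; ring
  rw [sum_abs_oneDim h0 h1, h5]
  refine div_le_div_of_nonneg_right ?_ (by linarith)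
  linarith

theorem one_le_sum_abs_oneDim {n : ℕ} (lam : ℝ) (i : Fin n) :
    1 ≤ ∑ j, |oneDim n lam i j| := by
  have h := Finset.single_le_sum (f := fun j => |oneDim n lam i j|)
    (fun j _ => abs_nonneg _) (Finset.mem_univ i)
  simpa [oneDim] using h

/-! ### The tridiagonal inverse -/

/-- The symmetric tridiagonal matrix with diagonal `d` and constant off-diagonal entry `b`. -/
def tridiag (n : ℕ) (d : ℕ → ℝ) (b : ℝ) : Matrix (Fin n) (Fin n) ℝ :=
  Matrix.of fun i j => (if i = j then d i else 0) +
    ((if (j : ℕ) + 1 = i then b else 0) + (if (i : ℕ) + 1 = j then b else 0))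

theorem isSymm_tridiag (n : ℕ) (d : ℕ → ℝ) (b : ℝ) : (tridiag n d b).IsSymm := by
  ext i j
  simp only [transpose_apply, tridiag, of_apply]
  rw [add_comm (ite ((i : ℕ) + 1 = j) b 0)]
  congr 1
  by_cases h : i = j
  · subst h; rfl
  · rw [if_neg h, if_neg (Ne.symm h)]

theorem sum_ite_succ_eq {n : ℕ} (g : ℕ → ℝ) (k : Fin n) :
    ∑ j : Fin n, (if (j : ℕ) + 1 = k then g j else 0) = if 1 ≤ (k : ℕ) then g (k - 1) else 0 := by
  have hk := k.isLt
  split_ifs with h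
  · rw [Finset.sum_eq_single ⟨(k : ℕ) - 1, by omega⟩]
    · rw [if_pos (by simp only; omega)]
    · intro j _ hj
      rw [if_neg]
      intro h'
      exact hj (Fin.ext (by simp only; omega))
    · simp
  · exact Finset.sum_eq_zero fun j _ => if_neg (by omega)

theorem sum_ite_eq_succ {n : ℕ} (g : ℕ → ℝ) (k : Fin n) :
    ∑ j : Fin n, (if (k : ℕ) + 1 = j then g j else 0) =
      if (k : ℕ) + 1 < n then g (k + 1) else 0 := by
  split_ifs with h
  · rw [Finset.sum_eq_single ⟨(k : ℕ) + 1, h⟩]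
    · simp
    · intro j _ hj
      rw [if_neg]
      intro h'
      exact hj (Fin.ext h'.symm)
    · simp
  · exact Finset.sum_eq_zero fun j _ => if_neg (by have := j.isLt; omega)

theorem sum_abs_tridiag_le {n : ℕ} (d : ℕ → ℝ) (b : ℝ) (i : Fin n) :
    ∑ j, |tridiag n d b i j| ≤
      |d i| + ((if 1 ≤ (i : ℕ) then |b| else 0) + (if (i : ℕ) + 1 < n then |b| else 0)) := by
  calc ∑ j, |tridiag n d b i j| ≤ ∑ j : Fin n, ((if i = j then |d i| else 0) +
        ((if (j : ℕ) + 1 = i then |b| else 0) + (if (i : ℕ) + 1 = j then |b| else 0))) := by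
        refine Finset.sum_le_sum fun j _ => (abs_add_le _ _).trans
          (add_le_add (le_of_eq ?_) ((abs_add_le _ _).trans (le_of_eq ?_)))
        · split_ifs <;> simp
        · congr 1 <;> split_ifs <;> simp
    _ = _ := by
        rw [Finset.sum_add_distrib, Finset.sum_add_distrib, sum_ite_succ_eq (fun _ => |b|),
          sum_ite_eq_succ (fun _ => |b|)]
        simp

/-- The inverse of `oneDim n lam`: up to the factor `1 / (1 - lam²)` it is tridiagonal, with
off-diagonal entries `-lam` and diagonal entries `1 + lam²`, except for a `1` in the two
corners. -/
def oneDimInv (n : ℕ) (lam : ℝ) : Matrix (Fin n) (Fin n) ℝ :=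
  tridiag n (fun i => (1 + (if 1 ≤ i ∧ i + 1 < n then lam ^ 2 else 0)) / (1 - lam ^ 2))
    (-lam / (1 - lam ^ 2))

/-- In column `k` of the product only the rows `k - 1`, `k`, `k + 1` of `oneDimInv` contribute; the
three terms cancel off the diagonal, the corner entries making up for the missing neighbour. -/
theorem oneDim_mul_oneDimInv {n : ℕ} (hn : 2 ≤ n) {lam : ℝ} (h0 : 0 < lam) (h1 : lam < 1) :
    oneDim n lam * oneDimInv n lam = 1 := by
  have hne : 1 - lam ^ 2 ≠ 0 := by nlinarith
  ext i k
  have hi := i.isLt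
  have hk := k.isLt
  -- row `i` of `oneDim`, extended to all natural column indices
  let q : ℕ → ℝ := fun j => lam ^ (((i : ℕ) : ℤ) - (j : ℤ)).natAbs
  have hsum : (oneDim n lam * oneDimInv n lam) i k =
      q k * ((1 + (if 1 ≤ (k : ℕ) ∧ (k : ℕ) + 1 < n then lam ^ 2 else 0)) / (1 - lam ^ 2)) +
      ((if 1 ≤ (k : ℕ) then q (k - 1) * (-lam / (1 - lam ^ 2)) else 0) +
      (if (k : ℕ) + 1 < n then q (k + 1) * (-lam / (1 - lam ^ 2)) else 0)) := by
    rw [← sum_ite_succ_eq (fun j => q j * (-lam / (1 - lam ^ 2))),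
      ← sum_ite_eq_succ (fun j => q j * (-lam / (1 - lam ^ 2))), ← Finset.sum_add_distrib,
      mul_apply]
    have hdiag : ∀ e : ℝ, q k * e = ∑ j : Fin n, if j = k then q k * e else 0 := by simp
    rw [hdiag, ← Finset.sum_add_distrib]
    refine Finset.sum_congr rfl fun j _ => ?_
    simp only [oneDim, oneDimInv, tridiag, of_apply, mul_add, mul_ite, mul_zero, q]
    rw [add_comm (ite ((k : ℕ) + 1 = j) _ _)]
    by_cases h : j = k
    · subst h; simp
    · simp [h]
  rw [hsum, one_apply]
  have hq : ∀ j : ℕ, q j = if j ≤ i then lam ^ ((i : ℕ) - j) else lam ^ (j - (i : ℕ)) := by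
    intro j
    simp only [q]
    split_ifs <;> congr 1 <;> omega
  rcases lt_trichotomy (i : ℕ) k with h | h | h
  · have hik : i ≠ k := fun e => by simp [e] at h
    obtain ⟨t, ht⟩ : ∃ t, (k : ℕ) = i + t + 1 := ⟨k - i - 1, by omega⟩
    have e0 : q k = lam * lam ^ t := by
      rw [hq, if_neg (by omega), ← pow_succ']; congr 1; omega
    have e1 : q (k - 1) = lam ^ t := by
      by_cases ht0 : t = 0
      · subst ht0
        rw [hq, if_pos (by omega)]; congr 1; omega
      · rw [hq, if_neg (by omega)]; congr 1; omega
    have e2 : q (k + 1) = lam * (lam * lam ^ t) := by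
      rw [hq, if_neg (by omega), ← pow_succ', ← pow_succ']; congr 1; omega
    rw [if_neg hik, e0, e1, e2, if_pos (show 1 ≤ (k : ℕ) by omega)]
    by_cases hkn : (k : ℕ) + 1 < n
    · rw [if_pos hkn, if_pos ⟨by omega, hkn⟩]; ring
    · rw [if_neg hkn, if_neg (fun h => hkn h.2)]; ring
  · have hik : i = k := Fin.ext h
    have e0 : q k = 1 := by rw [hq, if_pos h.ge, h]; simp
    have e1 : 1 ≤ (k : ℕ) → q (k - 1) = lam := fun hk1 => by
      rw [hq, if_pos (by omega), show (i : ℕ) - (k - 1) = 1 by omega, pow_one]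
    have e2 : q (k + 1) = lam := by
      rw [hq, if_neg (by omega), show (k : ℕ) + 1 - i = 1 by omega, pow_one]
    rw [if_pos hik, e0, e2]
    by_cases hk1 : 1 ≤ (k : ℕ)
    · rw [if_pos hk1, e1 hk1]
      by_cases hkn : (k : ℕ) + 1 < n
      · rw [if_pos hkn, if_pos ⟨hk1, hkn⟩]; field_simp; ring
      · rw [if_neg hkn, if_neg (fun h => hkn h.2)]; field_simp; ring
    · rw [if_neg hk1, if_neg (fun h => hk1 h.1), if_pos (show (k : ℕ) + 1 < n by omega)]
      field_simp; ring
  · have hik : i ≠ k := fun e => by simp [e] at h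
    obtain ⟨t, ht⟩ : ∃ t, (i : ℕ) = k + t + 1 := ⟨i - k - 1, by omega⟩
    have e0 : q k = lam * lam ^ t := by
      rw [hq, if_pos (by omega), ← pow_succ']; congr 1; omega
    have e1 : 1 ≤ (k : ℕ) → q (k - 1) = lam * (lam * lam ^ t) := fun hk1 => by
      rw [hq, if_pos (by omega), ← pow_succ', ← pow_succ']; congr 1; omega
    have e2 : q (k + 1) = lam ^ t := by
      rw [hq, if_pos (by omega)]; congr 1; omega
    rw [if_neg hik, e0, e2, if_pos (show (k : ℕ) + 1 < n by omega)]
    by_cases hk1 : 1 ≤ (k : ℕ)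
    · rw [if_pos hk1, e1 hk1, if_pos ⟨hk1, by omega⟩]; ring
    · rw [if_neg hk1, if_neg (fun h => hk1 h.1)]; ring

theorem isSymm_oneDimInv (n : ℕ) (lam : ℝ) : (oneDimInv n lam).IsSymm := isSymm_tridiag _ _ _

theorem sum_abs_oneDimInv_le {n : ℕ} {lam : ℝ} (h0 : 0 < lam) (h1 : lam < 1) (i : Fin n) :
    ∑ j, |oneDimInv n lam i j| ≤ (1 + lam) / (1 - lam) := by
  have hpos : 0 < 1 - lam ^ 2 := by nlinarith
  have h1' : 0 < 1 - lam := by linarith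
  refine (sum_abs_tridiag_le _ _ i).trans ?_
  have hb : |(-lam / (1 - lam ^ 2))| = lam / (1 - lam ^ 2) := by
    rw [neg_div, abs_neg, abs_of_pos (div_pos h0 hpos)]
  have hd : |(1 + (if 1 ≤ (i : ℕ) ∧ (i : ℕ) + 1 < n then lam ^ 2 else 0)) / (1 - lam ^ 2)| ≤
      (1 + lam ^ 2) / (1 - lam ^ 2) := by
    rw [abs_div, abs_of_pos hpos]
    refine div_le_div_of_nonneg_right ?_ hpos.le
    have h2 := sq_nonneg lam
    split_ifs
    · rw [abs_of_nonneg (by linarith)]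
    · simpa using h2
  have hs : ∀ p : Prop, [Decidable p] → (if p then lam / (1 - lam ^ 2) else 0) ≤
      lam / (1 - lam ^ 2) := fun p _ => by
    split_ifs
    · exact le_rfl
    · exact (div_pos h0 hpos).le
  rw [hb]
  refine (add_le_add hd (add_le_add (hs _) (hs _))).trans (le_of_eq ?_)
  have h3 : 1 - lam ^ 2 = (1 - lam) * (1 + lam) := by ring
  rw [h3]
  have : 1 + lam ≠ 0 := by linarith
  field_simp
  ring

/-- The smallest eigenvalue of `oneDimInv` is at least `(1 - lam) / (1 + lam)`: Schur's test applies
to the difference from `(1 + lam²) / (1 - lam²)` times the identity, whose absolute row sums are at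
most `2 lam / (1 - lam²)`. -/
theorem mul_dotProduct_le_oneDimInv {n : ℕ} (hn : 2 ≤ n) {lam : ℝ} (h0 : 0 < lam) (h1 : lam < 1)
    (x : Fin n → ℝ) : (1 - lam) / (1 + lam) * (x ⬝ᵥ x) ≤ x ⬝ᵥ oneDimInv n lam *ᵥ x := by
  have hpos : 0 < 1 - lam ^ 2 := by nlinarith
  set c := (1 + lam ^ 2) / (1 - lam ^ 2) with hc
  have heq : c • (1 : Matrix (Fin n) (Fin n) ℝ) - oneDimInv n lam =
      tridiag n (fun i => (if 1 ≤ i ∧ i + 1 < n then 0 else lam ^ 2) / (1 - lam ^ 2))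
        (lam / (1 - lam ^ 2)) := by
    ext i j
    simp only [oneDimInv, tridiag, of_apply, Matrix.sub_apply, Matrix.smul_apply, one_apply,
      smul_eq_mul]
    by_cases h : i = j
    · subst h
      simp only [if_true, hc]
      split_ifs <;> first | omega | (field_simp; ring)
    · rw [if_neg h, if_neg h, if_neg h]
      split_ifs <;> ring
  have hrow : ∀ i, ∑ j, |(c • (1 : Matrix (Fin n) (Fin n) ℝ) - oneDimInv n lam) i j| ≤
      2 * lam / (1 - lam ^ 2) := by
    intro i
    rw [heq]
    refine (sum_abs_tridiag_le _ _ i).trans ?_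
    rw [abs_of_pos (div_pos h0 hpos), abs_div, abs_of_pos hpos]
    have hi := i.isLt
    have hl : lam ^ 2 ≤ lam := by nlinarith
    have hl' : lam ^ 2 / (1 - lam ^ 2) ≤ lam / (1 - lam ^ 2) := by gcongr
    have h2 : 2 * lam / (1 - lam ^ 2) = lam / (1 - lam ^ 2) + lam / (1 - lam ^ 2) := by ring
    rw [h2]
    by_cases hi1 : 1 ≤ (i : ℕ)
    · by_cases hin : (i : ℕ) + 1 < n
      · simp [hi1, hin]
      · simp [hi1, hin, hl']
    · simp [hi1, show (i : ℕ) + 1 < n by omega, hl']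
  have hsymm : (c • (1 : Matrix (Fin n) (Fin n) ℝ) - oneDimInv n lam).IsSymm := by
    rw [heq]; exact isSymm_tridiag _ _ _
  have h := (le_abs_self _).trans (abs_dotProduct_mulVec_le_of_rowSum_le hsymm hrow x)
  rw [dotProduct_smul_one_sub_mulVec] at h
  have hcc : (1 - lam) / (1 + lam) = c - 2 * lam / (1 - lam ^ 2) := by
    have h3 : 1 - lam ^ 2 = (1 - lam) * (1 + lam) := by ring
    have h4 : 1 + lam ≠ 0 := by linarith
    have h5 : 1 - lam ≠ 0 := by linarith
    rw [hc, h3]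
    field_simp
    ring
  rw [hcc, sub_mul]
  linarith

theorem posDef_oneDimInv {n : ℕ} (hn : 2 ≤ n) {lam : ℝ} (h0 : 0 < lam) (h1 : lam < 1) :
    (oneDimInv n lam).PosDef := by
  refine PosDef.of_dotProduct_mulVec_pos ?_ fun x hx => ?_
  · exact (conjTranspose_eq_transpose_of_trivial _).trans (isSymm_oneDimInv n lam)
  · rw [star_trivial]
    refine lt_of_lt_of_le (mul_pos (div_pos (by linarith) (by linarith)) ?_)
      (mul_dotProduct_le_oneDimInv hn h0 h1 x)
    have := dotProduct_star_self_pos_iff.2 hx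
    rwa [star_trivial] at this

theorem inv_oneDim {n : ℕ} (hn : 2 ≤ n) {lam : ℝ} (h0 : 0 < lam) (h1 : lam < 1) :
    (oneDim n lam)⁻¹ = oneDimInv n lam :=
  inv_eq_right_inv (oneDim_mul_oneDimInv hn h0 h1)

theorem posDef_oneDim {n : ℕ} (hn : 2 ≤ n) {lam : ℝ} (h0 : 0 < lam) (h1 : lam < 1) :
    (oneDim n lam).PosDef := by
  rw [← inv_eq_left_inv (oneDim_mul_oneDimInv hn h0 h1)]
  exact (posDef_oneDimInv hn h0 h1).inv

/-! ### Upper bounds for the one-dimensional quadratic form -/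

/-- The `k`-th power of the strictly lower triangular part vanishes above the `k`-th
subdiagonal. -/
theorem strictLower_pow_apply_eq_zero (n : ℕ) (lam : ℝ) (k : ℕ) (i j : Fin n)
    (h : (i : ℕ) < j + k) : (strictLower n lam ^ k) i j = 0 := by
  induction k generalizing i j with
  | zero =>
    rw [pow_zero, one_apply_ne]
    intro e
    simp [e] at h
  | succ k ih =>
    rw [pow_succ, mul_apply]
    refine Finset.sum_eq_zero fun l _ => ?_
    by_cases hl : j < l
    · have : (j : ℕ) < l := hl
      rw [ih i l (by omega), zero_mul]
    · simp [strictLower, hl]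

theorem strictLower_pow_eq_zero (n : ℕ) (lam : ℝ) : strictLower n lam ^ n = 0 := by
  ext i j
  exact strictLower_pow_apply_eq_zero n lam n i j (by have := i.isLt; omega)

theorem dotProduct_strictLower_mulVec_le (n : ℕ) (lam : ℝ) (x : Fin n → ℝ) :
    x ⬝ᵥ strictLower n lam *ᵥ x ≤
      norm2 (strictLower n lam) * Real.cos (Real.pi / ((n : ℝ) + 1)) * (x ⬝ᵥ x) := by
  rw [← inner_toEuclideanCLM_self, ← norm_toLp_sq]
  refine inner_apply_self_le_norm_mul_cos _ ?_ _
  rw [← map_pow, strictLower_pow_eq_zero, map_zero]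

theorem dotProduct_oneDim_mulVec (n : ℕ) (lam : ℝ) (x : Fin n → ℝ) :
    x ⬝ᵥ oneDim n lam *ᵥ x = x ⬝ᵥ x + 2 * (x ⬝ᵥ strictLower n lam *ᵥ x) := by
  have h : x ⬝ᵥ (strictLower n lam)ᵀ *ᵥ x = x ⬝ᵥ strictLower n lam *ᵥ x := by
    rw [mulVec_transpose, dotProduct_comm, dotProduct_mulVec]
  rw [oneDim_eq, add_mulVec, add_mulVec, one_mulVec, dotProduct_add, dotProduct_add, h]
  ring

theorem oneDim_le_cos (n : ℕ) (lam : ℝ) :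
    ((1 + 2 * norm2 (strictLower n lam) * Real.cos (Real.pi / ((n : ℝ) + 1))) •
      (1 : Matrix (Fin n) (Fin n) ℝ) - oneDim n lam).PosSemidef := by
  rw [posSemidef_smul_one_sub_iff (isSymm_oneDim n lam)]
  intro x
  rw [dotProduct_oneDim_mulVec]
  linarith [dotProduct_strictLower_mulVec_le n lam x]

theorem oneDim_le_rowSum {n : ℕ} (hn : 2 ≤ n) {lam : ℝ} (h0 : 0 < lam) (h1 : lam < 1) :
    (((1 + lam) * (1 - lam ^ (n - 1)) / (1 - lam)) •
      (1 : Matrix (Fin n) (Fin n) ℝ) - oneDim n lam).PosSemidef := by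
  rw [posSemidef_smul_one_sub_iff (isSymm_oneDim n lam)]
  exact fun x => (le_abs_self _).trans
    (abs_dotProduct_mulVec_le_of_rowSum_le (isSymm_oneDim n lam) (sum_abs_oneDim_le hn h0 h1) x)

theorem rowBound_pos {n : ℕ} (hn : 2 ≤ n) {lam : ℝ} (h0 : 0 < lam) (h1 : lam < 1) :
    0 < (1 + lam) * (1 - lam ^ (n - 1)) / (1 - lam) := by
  have h : lam ^ (n - 1) < 1 := pow_lt_one₀ h0.le h1 (by omega)
  have h2 : 0 < 1 - lam ^ (n - 1) := by linarith
  have h3 : 0 < 1 - lam := by linarith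
  positivity

theorem rowBound_lt {n : ℕ} {lam : ℝ} (h0 : 0 < lam) (h1 : lam < 1) :
    (1 + lam) * (1 - lam ^ (n - 1)) / (1 - lam) < (1 + lam) / (1 - lam) := by
  refine div_lt_div_of_pos_right ?_ (by linarith)
  nlinarith [pow_pos h0 (n - 1)]

/-- Each of the three terms of `minBound` dominates a bound for the quadratic form: the first is
`1 + 2 ‖L‖`, the other two exceed the row-sum bound. -/
theorem oneDim_le_minBound {n : ℕ} (hn : 2 ≤ n) {lam : ℝ} (h0 : 0 < lam) (h1 : lam < 1) :
    (minBound n lam • (1 : Matrix (Fin n) (Fin n) ℝ) - oneDim n lam).PosSemidef := by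
  have hsymm := isSymm_oneDim n lam
  rw [posSemidef_smul_one_sub_iff hsymm]
  intro x
  have hxx : 0 ≤ x ⬝ᵥ x := by
    have := dotProduct_star_self_nonneg x
    rwa [star_trivial] at this
  have hrow := (posSemidef_smul_one_sub_iff hsymm _).1 (oneDim_le_rowSum hn h0 h1) x
  have hpos := rowBound_pos hn h0 h1
  have h3 : 0 < 1 - lam := by linarith
  rw [minBound, min_mul_of_nonneg _ _ hxx, min_mul_of_nonneg _ _ hxx]
  refine le_min ?_ (le_min ?_ ?_)
  · rw [dotProduct_oneDim_mulVec]
    linarith [dotProduct_mulVec_le_norm2 (strictLower n lam) x]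
  · refine hrow.trans (mul_le_mul_of_nonneg_right ?_ hxx)
    refine (rowBound_lt h0 h1).le.trans (div_le_div_of_nonneg_right ?_ h3.le)
    linarith
  · refine hrow.trans (mul_le_mul_of_nonneg_right ?_ hxx)
    rw [mul_assoc 2, mul_div_assoc 2]
    linarith

theorem minBound_nonneg {n : ℕ} {lam : ℝ} (h0 : 0 < lam) (h1 : lam < 1) :
    0 ≤ minBound n lam := by
  have h3 : 0 < 1 - lam := by linarith
  have h : 0 ≤ 1 - lam ^ (n - 1) := sub_nonneg.2 (pow_le_one₀ h0.le h1.le)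
  refine le_min ?_ (le_min (div_nonneg (by linarith) h3.le) (by positivity))
  have : 0 ≤ norm2 (strictLower n lam) := norm_nonneg _
  positivity

theorem oneDimInv_le {n : ℕ} {lam : ℝ} (h0 : 0 < lam) (h1 : lam < 1) :
    (((1 + lam) / (1 - lam)) • (1 : Matrix (Fin n) (Fin n) ℝ) - oneDimInv n lam).PosSemidef := by
  rw [posSemidef_smul_one_sub_iff (isSymm_oneDimInv n lam)]
  exact fun x => (le_abs_self _).trans
    (abs_dotProduct_mulVec_le_of_rowSum_le (isSymm_oneDimInv n lam) (sum_abs_oneDimInv_le h0 h1) x)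

theorem oneDimInv_zero_zero {n : ℕ} (hn : 2 ≤ n) (lam : ℝ) :
    oneDimInv n lam ⟨0, by omega⟩ ⟨0, by omega⟩ = 1 / (1 - lam ^ 2) := by
  simp [oneDimInv, tridiag]

theorem le_sum_abs_oneDimInv {n : ℕ} (hn : 2 ≤ n) {lam : ℝ} (h0 : 0 < lam) (h1 : lam < 1) :
    1 / (1 - lam) ≤ ∑ j, |oneDimInv n lam ⟨0, by omega⟩ j| := by
  have hpos : 0 < 1 - lam ^ 2 := by nlinarith
  have h := Finset.sum_le_sum_of_subset_of_nonneg
    (f := fun j => |oneDimInv n lam ⟨0, by omega⟩ j|)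
    (Finset.subset_univ {(⟨0, by omega⟩ : Fin n), ⟨1, by omega⟩}) (fun j _ _ => abs_nonneg _)
  rw [Finset.sum_pair (by simp), oneDimInv_zero_zero hn] at h
  refine le_trans (le_of_eq ?_) h
  have hb : oneDimInv n lam ⟨0, by omega⟩ ⟨1, by omega⟩ = -lam / (1 - lam ^ 2) := by
    simp [oneDimInv, tridiag]
  rw [hb, neg_div, abs_neg, abs_of_pos (div_pos h0 hpos), abs_of_pos (one_div_pos.2 hpos),
    ← add_div]
  have h3 : 1 - lam ^ 2 = (1 - lam) * (1 + lam) := by ring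
  have h4 : 1 + lam ≠ 0 := by linarith
  have h5 : 1 - lam ≠ 0 := by linarith
  rw [h3]
  field_simp

end OneDim

/-! ### Norms and spectrum of the Kronecker product -/

section TwoDim

variable {ι κ : Type*} [Fintype ι] [Fintype κ]

theorem norm1_eq_normInf {A : Matrix ι ι ℝ} (hA : A.IsSymm) : norm1 A = normInf A := by
  simp only [norm1, normInf, hA.apply]

theorem le_normInf (A : Matrix ι ι ℝ) (i : ι) : ∑ j, |A i j| ≤ normInf A :=
  le_ciSup (f := fun i => ∑ j, |A i j|) (Set.finite_range _).bddAbove i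

theorem normInf_le {A : Matrix ι ι ℝ} [Nonempty ι] {c : ℝ} (h : ∀ i, ∑ j, |A i j| ≤ c) :
    normInf A ≤ c := ciSup_le h

theorem sum_abs_kronecker (B : Matrix κ κ ℝ) (A : Matrix ι ι ℝ) (p : κ × ι) :
    ∑ q, |(B ⊗ₖ A) p q| = (∑ j, |B p.1 j|) * ∑ j, |A p.2 j| := by
  rw [Fintype.sum_prod_type, Finset.sum_mul_sum]
  simp only [kroneckerMap_apply, abs_mul]

theorem normInf_kronecker_le {B : Matrix κ κ ℝ} {A : Matrix ι ι ℝ} [Nonempty κ] [Nonempty ι]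
    {a b : ℝ} (hB : ∀ i, ∑ j, |B i j| ≤ b) (hA : ∀ i, ∑ j, |A i j| ≤ a) (hb : 0 ≤ b) :
    normInf (B ⊗ₖ A) ≤ b * a := by
  refine normInf_le fun p => ?_
  rw [sum_abs_kronecker]
  exact mul_le_mul (hB _) (hA _) (Finset.sum_nonneg fun _ _ => abs_nonneg _) hb

theorem apply_self_le_norm2 [DecidableEq ι] (A : Matrix ι ι ℝ) (i : ι) : A i i ≤ norm2 A := by
  simpa using dotProduct_mulVec_le_norm2 A (Pi.single i 1)

theorem dotProduct_prod (v v' : κ → ℝ) (u u' : ι → ℝ) :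
    (fun p : κ × ι => v p.1 * u p.2) ⬝ᵥ (fun p : κ × ι => v' p.1 * u' p.2) =
      (v ⬝ᵥ v') * (u ⬝ᵥ u') := by
  simp only [dotProduct, Fintype.sum_prod_type, Finset.sum_mul_sum]
  exact Finset.sum_congr rfl fun _ _ => Finset.sum_congr rfl fun _ _ => by ring

theorem kronecker_mulVec_prod (B : Matrix κ κ ℝ) (A : Matrix ι ι ℝ) (v : κ → ℝ) (u : ι → ℝ) :
    (B ⊗ₖ A) *ᵥ (fun p : κ × ι => v p.1 * u p.2) =
      fun p => (B *ᵥ v) p.1 * (A *ᵥ u) p.2 := by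
  ext p
  simp only [mulVec, dotProduct, Fintype.sum_prod_type, Finset.sum_mul_sum, kroneckerMap_apply]
  exact Finset.sum_congr rfl fun _ _ => Finset.sum_congr rfl fun _ _ => by ring

/-- The test vector `e₀ + e₁` has Rayleigh quotient `1 + lam`. -/
theorem exists_oneDim_rayleigh {n : ℕ} (hn : 2 ≤ n) (lam : ℝ) :
    ∃ u : Fin n → ℝ, u ⬝ᵥ u = 2 ∧ u ⬝ᵥ oneDim n lam *ᵥ u = 2 * (1 + lam) := by
  have h01 : (⟨0, by omega⟩ : Fin n) ≠ ⟨1, by omega⟩ := by simp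
  refine ⟨Pi.single ⟨0, by omega⟩ 1 + Pi.single ⟨1, by omega⟩ 1, ?_, ?_⟩
  · simp
    norm_num
  · simp [mulVec_add, oneDim]
    ring

theorem isSymm_twoDim (n m : ℕ) (lam₁ lam₂ : ℝ) : (twoDim n m lam₁ lam₂).IsSymm := by
  rw [IsSymm, twoDim, ← kroneckerMap_transpose, isSymm_oneDim, isSymm_oneDim]

variable {n m : ℕ} {lam₁ lam₂ : ℝ}

theorem posDef_twoDim (hn : 2 ≤ n) (hm : 2 ≤ m)
    (h₁ : 0 < lam₁) (h₁' : lam₁ < 1) (h₂ : 0 < lam₂) (h₂' : lam₂ < 1) :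
    (twoDim n m lam₁ lam₂).PosDef :=
  (posDef_oneDim hm h₂ h₂').kronecker (posDef_oneDim hn h₁ h₁')

theorem inv_twoDim (hn : 2 ≤ n) (hm : 2 ≤ m)
    (h₁ : 0 < lam₁) (h₁' : lam₁ < 1) (h₂ : 0 < lam₂) (h₂' : lam₂ < 1) :
    (twoDim n m lam₁ lam₂)⁻¹ = oneDimInv m lam₂ ⊗ₖ oneDimInv n lam₁ := by
  rw [twoDim, inv_kronecker, inv_oneDim hn h₁ h₁', inv_oneDim hm h₂ h₂']

theorem isSymm_inv_twoDim (hn : 2 ≤ n) (hm : 2 ≤ m)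
    (h₁ : 0 < lam₁) (h₁' : lam₁ < 1) (h₂ : 0 < lam₂) (h₂' : lam₂ < 1) :
    (twoDim n m lam₁ lam₂)⁻¹.IsSymm := by
  rw [inv_twoDim hn hm h₁ h₁' h₂ h₂', IsSymm, ← kroneckerMap_transpose, isSymm_oneDimInv,
    isSymm_oneDimInv]

theorem twoDim_le (hm : 2 ≤ m) (h₂ : 0 < lam₂) (h₂' : lam₂ < 1) {a b : ℝ} (ha : 0 ≤ a)
    (hA : (a • (1 : Matrix (Fin n) (Fin n) ℝ) - oneDim n lam₁).PosSemidef)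
    (hB : (b • (1 : Matrix (Fin m) (Fin m) ℝ) - oneDim m lam₂).PosSemidef) :
    ((a * b) • (1 : Matrix (Fin m × Fin n) (Fin m × Fin n) ℝ) -
      twoDim n m lam₁ lam₂).PosSemidef := by
  rw [mul_comm a]
  exact posSemidef_smul_one_sub_kronecker (posDef_oneDim hm h₂ h₂').posSemidef ha hA hB

theorem le_rho_twoDim (hn : 2 ≤ n) (hm : 2 ≤ m) (lam₁ lam₂ : ℝ) :
    (1 + lam₁) * (1 + lam₂) ≤ rho (twoDim n m lam₁ lam₂) := by
  obtain ⟨u, hu, hu'⟩ := exists_oneDim_rayleigh hn lam₁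
  obtain ⟨v, hv, hv'⟩ := exists_oneDim_rayleigh hm lam₂
  have h := dotProduct_mulVec_le_rho (isSymm_twoDim n m lam₁ lam₂) (fun p => v p.1 * u p.2)
  rw [twoDim, kronecker_mulVec_prod, dotProduct_prod, dotProduct_prod, hu, hu', hv, hv'] at h
  rw [twoDim]
  linarith

theorem norm1_twoDim_eq_normInf : norm1 (twoDim n m lam₁ lam₂) = normInf (twoDim n m lam₁ lam₂) :=
  norm1_eq_normInf (isSymm_twoDim n m lam₁ lam₂)

theorem one_le_norm1_twoDim (hn : 2 ≤ n) (hm : 2 ≤ m) (lam₁ lam₂ : ℝ) :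
    1 ≤ norm1 (twoDim n m lam₁ lam₂) := by
  rw [norm1_twoDim_eq_normInf]
  refine le_trans ?_ (le_normInf _ (⟨0, by omega⟩, ⟨0, by omega⟩))
  rw [twoDim, sum_abs_kronecker]
  exact one_le_mul_of_one_le_of_one_le (one_le_sum_abs_oneDim _ _) (one_le_sum_abs_oneDim _ _)

theorem norm1_twoDim_le (hn : 2 ≤ n) (hm : 2 ≤ m)
    (h₁ : 0 < lam₁) (h₁' : lam₁ < 1) (h₂ : 0 < lam₂) (h₂' : lam₂ < 1) :
    norm1 (twoDim n m lam₁ lam₂) ≤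
      (1 + 2 * lam₁ * (1 - lam₁ ^ (n - 1)) / (1 - lam₁)) *
        (1 + 2 * lam₂ * (1 - lam₂ ^ (m - 1)) / (1 - lam₂)) := by
  have : Nonempty (Fin n) := ⟨⟨0, by omega⟩⟩
  have : Nonempty (Fin m) := ⟨⟨0, by omega⟩⟩
  rw [norm1_twoDim_eq_normInf, mul_comm]
  refine normInf_kronecker_le (sum_abs_oneDim_le_one_add h₂ h₂')
    (sum_abs_oneDim_le_one_add h₁ h₁') ?_
  exact zero_le_one.trans ((one_le_sum_abs_oneDim lam₂ (Classical.arbitrary _)).trans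
    (sum_abs_oneDim_le_one_add h₂ h₂' _))

theorem one_le_norm2_twoDim (hn : 2 ≤ n) (hm : 2 ≤ m) (lam₁ lam₂ : ℝ) :
    1 ≤ norm2 (twoDim n m lam₁ lam₂) := by
  have h := apply_self_le_norm2 (twoDim n m lam₁ lam₂) (⟨0, by omega⟩, ⟨0, by omega⟩)
  simpa [twoDim, oneDim] using h

theorem norm2_twoDim_le (hn : 2 ≤ n) (hm : 2 ≤ m)
    (h₁ : 0 < lam₁) (h₁' : lam₁ < 1) (h₂ : 0 < lam₂) (h₂' : lam₂ < 1) :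
    norm2 (twoDim n m lam₁ lam₂) ≤ minBound n lam₁ * minBound m lam₂ :=
  norm2_le_of_posSemidef (posDef_twoDim hn hm h₁ h₁' h₂ h₂').posSemidef
    (mul_nonneg (minBound_nonneg h₁ h₁') (minBound_nonneg h₂ h₂'))
    (twoDim_le hm h₂ h₂' (minBound_nonneg h₁ h₁') (oneDim_le_minBound hn h₁ h₁')
      (oneDim_le_minBound hm h₂ h₂'))

theorem norm1_inv_twoDim_le (hn : 2 ≤ n) (hm : 2 ≤ m)
    (h₁ : 0 < lam₁) (h₁' : lam₁ < 1) (h₂ : 0 < lam₂) (h₂' : lam₂ < 1) :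
    norm1 (twoDim n m lam₁ lam₂)⁻¹ ≤
      (1 + lam₁) * (1 + lam₂) / ((1 - lam₁) * (1 - lam₂)) := by
  have : Nonempty (Fin n) := ⟨⟨0, by omega⟩⟩
  have : Nonempty (Fin m) := ⟨⟨0, by omega⟩⟩
  rw [norm1_eq_normInf (isSymm_inv_twoDim hn hm h₁ h₁' h₂ h₂'),
    inv_twoDim hn hm h₁ h₁' h₂ h₂', mul_div_mul_comm, mul_comm]
  exact normInf_kronecker_le (sum_abs_oneDimInv_le h₂ h₂') (sum_abs_oneDimInv_le h₁ h₁')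
    (div_nonneg (by linarith) (by linarith))

/-- The comparison behind the lower bound for the 1-norm of the inverse: row `0` of `oneDimInv` has
absolute sum `1 / (1 - lam)`, which dominates the stated quantity because `lam ^ n ≤ lam`. -/
theorem div_le_one_div_one_sub {n : ℕ} (hn : 2 ≤ n) {lam : ℝ} (h0 : 0 < lam) (h1 : lam < 1) :
    (1 - lam) / ((1 + lam) * (1 - lam ^ n) ^ 2) ≤ 1 / (1 - lam) := by
  have h2 : lam ^ n ≤ lam := pow_le_of_le_one h0.le h1.le (by omega)
  have h3 : 0 < 1 - lam := by linarith
  have h4 : 0 < 1 - lam ^ n := by linarith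
  rw [div_le_div_iff₀ (by positivity) h3]
  have h5 : (1 - lam) ^ 2 ≤ (1 - lam ^ n) ^ 2 := by gcongr
  nlinarith [mul_nonneg h0.le (sq_nonneg (1 - lam ^ n))]

theorem le_norm1_inv_twoDim (hn : 2 ≤ n) (hm : 2 ≤ m)
    (h₁ : 0 < lam₁) (h₁' : lam₁ < 1) (h₂ : 0 < lam₂) (h₂' : lam₂ < 1) :
    (1 - lam₁) * (1 - lam₂) /
      ((1 + lam₁) * (1 + lam₂) * (1 - lam₁ ^ n) ^ 2 * (1 - lam₂ ^ m) ^ 2) ≤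
      norm1 (twoDim n m lam₁ lam₂)⁻¹ := by
  have hp₁ : 0 < 1 - lam₁ := by linarith
  have hp₂ : 0 < 1 - lam₂ := by linarith
  rw [norm1_eq_normInf (isSymm_inv_twoDim hn hm h₁ h₁' h₂ h₂')]
  refine le_trans ?_ (le_normInf _ (⟨0, by omega⟩, ⟨0, by omega⟩))
  rw [inv_twoDim hn hm h₁ h₁' h₂ h₂', sum_abs_kronecker]
  calc _ = (1 - lam₂) / ((1 + lam₂) * (1 - lam₂ ^ m) ^ 2) *
        ((1 - lam₁) / ((1 + lam₁) * (1 - lam₁ ^ n) ^ 2)) := by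
        rw [div_mul_div_comm]; congr 1 <;> ring
    _ ≤ 1 / (1 - lam₂) * (1 / (1 - lam₁)) := by
        refine mul_le_mul (div_le_one_div_one_sub hm h₂ h₂') (div_le_one_div_one_sub hn h₁ h₁')
          ?_ ?_ <;> positivity
    _ ≤ _ := by
        refine mul_le_mul (le_sum_abs_oneDimInv hm h₂ h₂') (le_sum_abs_oneDimInv hn h₁ h₁')
          (by positivity) (Finset.sum_nonneg fun _ _ => abs_nonneg _)

theorem norm2_inv_twoDim_le (hn : 2 ≤ n) (hm : 2 ≤ m)
    (h₁ : 0 < lam₁) (h₁' : lam₁ < 1) (h₂ : 0 < lam₂) (h₂' : lam₂ < 1) :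
    norm2 (twoDim n m lam₁ lam₂)⁻¹ ≤
      (1 + lam₁) * (1 + lam₂) / ((1 - lam₁) * (1 - lam₂)) := by
  have hp₁ : 0 < 1 - lam₁ := by linarith
  have hp₂ : 0 < 1 - lam₂ := by linarith
  rw [inv_twoDim hn hm h₁ h₁' h₂ h₂', mul_div_mul_comm, mul_comm]
  have hpd := posDef_oneDimInv hm h₂ h₂'
  exact norm2_le_of_posSemidef (hpd.kronecker (posDef_oneDimInv hn h₁ h₁')).posSemidef
    (by positivity)
    (posSemidef_smul_one_sub_kronecker hpd.posSemidef (by positivity) (oneDimInv_le h₁ h₁')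
      (oneDimInv_le h₂ h₂'))

theorem one_le_norm2_inv_twoDim (hn : 2 ≤ n) (hm : 2 ≤ m)
    (h₁ : 0 < lam₁) (h₁' : lam₁ < 1) (h₂ : 0 < lam₂) (h₂' : lam₂ < 1) :
    1 ≤ norm2 (twoDim n m lam₁ lam₂)⁻¹ := by
  have h := apply_self_le_norm2 (twoDim n m lam₁ lam₂)⁻¹ (⟨0, by omega⟩, ⟨0, by omega⟩)
  refine le_trans ?_ h
  rw [inv_twoDim hn hm h₁ h₁' h₂ h₂', kroneckerMap_apply, oneDimInv_zero_zero hn,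
    oneDimInv_zero_zero hm]
  refine one_le_mul_of_one_le_of_one_le ?_ ?_
  · rw [le_div_iff₀ (by nlinarith)]; nlinarith
  · rw [le_div_iff₀ (by nlinarith)]; nlinarith

end TwoDim

end WassersteinMetric

open WassersteinMetric in
theorem mainTheorem2 (n m : ℕ) (hn : 2 ≤ n) (hm : 2 ≤ m) (lam₁ lam₂ : ℝ)
    (h₁ : 0 < lam₁) (h₁' : lam₁ < 1) (h₂ : 0 < lam₂) (h₂' : lam₂ < 1) :
    IsUnit (twoDim n m lam₁ lam₂) ∧
    -- (i)
    (lam₁ ≤ 1 / 3 → lam₂ ≤ 1 / 3 →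
      ∀ α ∈ sigma (twoDim n m lam₁ lam₂), ∃ a : ℝ, α = (a : ℂ) ∧ 0 < a ∧ a < 4) ∧
    -- (ii)
    (∀ α ∈ sigma (twoDim n m lam₁ lam₂), ∃ a : ℝ, α = (a : ℂ) ∧ 0 < a ∧
      a ≤ (1 + 2 * norm2 (strictLower n lam₁) * Real.cos (Real.pi / ((n : ℝ) + 1))) *
        (1 + 2 * norm2 (strictLower m lam₂) * Real.cos (Real.pi / ((m : ℝ) + 1)))) ∧
    -- (iii)
    (1 + lam₁) * (1 + lam₂) ≤ rho (twoDim n m lam₁ lam₂) ∧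
    -- (iv)
    (∀ z ∈ numRange (twoDim n m lam₁ lam₂), ∃ a : ℝ, z = (a : ℂ) ∧ 0 < a ∧
      a ≤ (1 + lam₁) * (1 + lam₂) * (1 - lam₁ ^ (n - 1)) * (1 - lam₂ ^ (m - 1)) /
        ((1 - lam₁) * (1 - lam₂))) ∧
    -- (v)
    (norm1 (twoDim n m lam₁ lam₂) = normInf (twoDim n m lam₁ lam₂) ∧
      1 / ((1 + lam₁) ^ 2 * (1 + lam₂) ^ 2) ≤ norm1 (twoDim n m lam₁ lam₂) ∧
      norm1 (twoDim n m lam₁ lam₂) ≤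
        (1 + 2 * lam₁ * (1 - lam₁ ^ (n - 1)) / (1 - lam₁)) *
          (1 + 2 * lam₂ * (1 - lam₂ ^ (m - 1)) / (1 - lam₂))) ∧
    -- (vi)
    (1 / ((1 + lam₁) ^ 2 * (1 + lam₂) ^ 2) ≤ norm2 (twoDim n m lam₁ lam₂) ∧
      norm2 (twoDim n m lam₁ lam₂) ≤ minBound n lam₁ * minBound m lam₂) ∧
    -- (vii)
    (norm1 ((twoDim n m lam₁ lam₂)⁻¹) = normInf ((twoDim n m lam₁ lam₂)⁻¹) ∧
      (1 - lam₁) * (1 - lam₂) /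
          ((1 + lam₁) * (1 + lam₂) * (1 - lam₁ ^ n) ^ 2 * (1 - lam₂ ^ m) ^ 2) ≤
        norm1 ((twoDim n m lam₁ lam₂)⁻¹)) ∧
    -- (viii)
    ((1 - lam₁) * (1 - lam₂) / ((1 + lam₁) * (1 + lam₂)) ≤
        norm2 ((twoDim n m lam₁ lam₂)⁻¹) ∧
      norm2 ((twoDim n m lam₁ lam₂)⁻¹) ≤
        (1 + lam₁) * (1 + lam₂) / ((1 - lam₁) * (1 - lam₂))) ∧
    -- (ix)
    (kappa1 (twoDim n m lam₁ lam₂) = kappaInf (twoDim n m lam₁ lam₂) ∧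
      (1 - lam₁) * (1 - lam₂) /
          ((1 + lam₁) ^ 3 * (1 + lam₂) ^ 3 * (1 - lam₁ ^ n) ^ 2 * (1 - lam₂ ^ m) ^ 2) ≤
        kappa1 (twoDim n m lam₁ lam₂) ∧
      kappa1 (twoDim n m lam₁ lam₂) ≤
        (1 + lam₁) * (1 + lam₂) * (1 - lam₁ + 2 * lam₁ * (1 - lam₁ ^ (n - 1))) *
            (1 - lam₂ + 2 * lam₂ * (1 - lam₂ ^ (m - 1))) /
          ((1 - lam₁) ^ 2 * (1 - lam₂) ^ 2)) ∧
    -- (x)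
    ((1 - lam₁) * (1 - lam₂) / ((1 + lam₁) ^ 3 * (1 + lam₂) ^ 3) ≤
        kappa2 (twoDim n m lam₁ lam₂) ∧
      kappa2 (twoDim n m lam₁ lam₂) ≤
        minBound n lam₁ * minBound m lam₂ *
          ((1 + lam₁) * (1 + lam₂) / ((1 - lam₁) * (1 - lam₂)))) := by
  have hp₁ : 0 < 1 - lam₁ := by linarith
  have hp₂ : 0 < 1 - lam₂ := by linarith
  have hr₁ := rowBound_pos hn h₁ h₁'
  have hr₂ := rowBound_pos hm h₂ h₂'
  have hQ := posDef_twoDim hn hm h₁ h₁' h₂ h₂'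
  have hrange : ∀ z ∈ numRange (twoDim n m lam₁ lam₂), ∃ a : ℝ, z = (a : ℂ) ∧ 0 < a ∧
      a ≤ (1 + lam₁) * (1 - lam₁ ^ (n - 1)) / (1 - lam₁) *
        ((1 + lam₂) * (1 - lam₂ ^ (m - 1)) / (1 - lam₂)) := fun z hz =>
    numRange_bounds hQ (twoDim_le hm h₂ h₂' hr₁.le (oneDim_le_rowSum hn h₁ h₁')
      (oneDim_le_rowSum hm h₂ h₂')) hz
  -- the stated lower bounds on the norms of `Q`, and on the 2-norm of `Q⁻¹`, are at most `1`,
  -- while a diagonal entry already forces these norms to be at least `1`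
  have hone : 1 / ((1 + lam₁) ^ 2 * (1 + lam₂) ^ 2) ≤ 1 := by
    rw [div_le_one (by positivity)]
    exact one_le_mul_of_one_le_of_one_le (one_le_pow₀ (by linarith)) (one_le_pow₀ (by linarith))
  have hsmall : (1 - lam₁) * (1 - lam₂) / ((1 + lam₁) * (1 + lam₂)) ≤ 1 := by
    rw [div_le_one (by positivity)]
    exact mul_le_mul (by linarith) (by linarith) hp₂.le (by linarith)
  have hn1 := one_le_norm1_twoDim hn hm lam₁ lam₂
  have hn2 := one_le_norm2_twoDim hn hm lam₁ lam₂
  have hi1 := le_norm1_inv_twoDim hn hm h₁ h₁' h₂ h₂'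
  have hi2 := one_le_norm2_inv_twoDim hn hm h₁ h₁' h₂ h₂'
  have heq := norm1_twoDim_eq_normInf (n := n) (m := m) (lam₁ := lam₁) (lam₂ := lam₂)
  have heq' := norm1_eq_normInf (isSymm_inv_twoDim hn hm h₁ h₁' h₂ h₂')
  refine ⟨hQ.isUnit, ?_, ?_, le_rho_twoDim hn hm lam₁ lam₂, ?_,
    ⟨heq, hone.trans hn1, norm1_twoDim_le hn hm h₁ h₁' h₂ h₂'⟩,
    ⟨hone.trans hn2, norm2_twoDim_le hn hm h₁ h₁' h₂ h₂'⟩, ⟨heq', hi1⟩,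
    ⟨hsmall.trans hi2, norm2_inv_twoDim_le hn hm h₁ h₁' h₂ h₂'⟩, ⟨?_, ?_, ?_⟩, ?_, ?_⟩
  · intro hl₁ hl₂ α hα
    obtain ⟨a, rfl, ha, hle⟩ := hrange α (sigma_subset_numRange _ hα)
    -- for `l ≤ 1 / 3` each factor of the row-sum bound is strictly below `(1 + l) / (1 - l) ≤ 2`
    have hb : ∀ l : ℝ, 0 < 1 - l → l ≤ 1 / 3 → (1 + l) / (1 - l) ≤ 2 := fun l hl hl' => by
      rw [div_le_iff₀ hl]; linarith
    have hb₁ := (rowBound_lt (n := n) h₁ h₁').trans_le (hb _ hp₁ hl₁)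
    have hb₂ := (rowBound_lt (n := m) h₂ h₂').trans_le (hb _ hp₂ hl₂)
    exact ⟨a, rfl, ha, by nlinarith⟩
  · intro α hα
    refine numRange_bounds hQ (twoDim_le hm h₂ h₂' ?_ (oneDim_le_cos n lam₁)
      (oneDim_le_cos m lam₂)) (sigma_subset_numRange _ hα)
    -- `n ≥ 2` puts the angle in the first quadrant
    have hcos : 0 ≤ Real.cos (Real.pi / ((n : ℝ) + 1)) := by
      have hn' : (2 : ℝ) ≤ n := by exact_mod_cast hn
      have hpi := Real.pi_pos
      refine Real.cos_nonneg_of_mem_Icc ⟨?_, ?_⟩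
      · exact le_trans (by linarith) (by positivity : (0 : ℝ) ≤ Real.pi / ((n : ℝ) + 1))
      · exact div_le_div_of_nonneg_left hpi.le two_pos (by linarith)
    have hL : 0 ≤ norm2 (strictLower n lam₁) := norm_nonneg _
    positivity
  · intro z hz
    obtain ⟨a, rfl, ha, hle⟩ := hrange z hz
    refine ⟨a, rfl, ha, hle.trans (le_of_eq ?_)⟩
    rw [div_mul_div_comm]
    congr 1
    ring
  · rw [kappa1, kappaInf, heq, heq']
  · rw [kappa1]
    have h := mul_le_mul (hone.trans hn1) hi1 (by positivity) (zero_le_one.trans hn1)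
    refine le_trans (le_of_eq ?_) h
    rw [div_mul_div_comm, one_mul]
    congr 1
    ring
  · rw [kappa1]
    have h := mul_le_mul (norm1_twoDim_le hn hm h₁ h₁' h₂ h₂')
      (norm1_inv_twoDim_le hn hm h₁ h₁' h₂ h₂') (le_trans (by positivity) hi1)
      ((zero_le_one.trans hn1).trans (norm1_twoDim_le hn hm h₁ h₁' h₂ h₂'))
    refine h.trans (le_of_eq ?_)
    field_simp
  · rw [kappa2]
    have h := mul_le_mul (hone.trans hn2) (hsmall.trans hi2) (by positivity)
      (zero_le_one.trans hn2)
    refine le_trans (le_of_eq ?_) h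
    rw [div_mul_div_comm, one_mul]
    congr 1
    ring
  · rw [kappa2]
    exact mul_le_mul (norm2_twoDim_le hn hm h₁ h₁' h₂ h₂')
      (norm2_inv_twoDim_le hn hm h₁ h₁' h₂ h₂') (zero_le_one.trans hi2)
      (mul_nonneg (minBound_nonneg h₁ h₁') (minBound_nonneg h₂ h₂'))
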